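/- **Setting.** Let $\mathbb T^2=(\mathbb R/2\pi\mathbb Z)^2$ with the normalized Lebesgue measure, let $J=\begin{pmatrix}0&1\\-1&0\end{pmatrix}$, and for an integer $s\ge 0$ let $H^s(\mathbb T^2)$ be the Sobolev space with norm $\|f\|_{H^s}=\big(\sum_{k\in\mathbb Z^2}|\hat f_k|^2(1+|k|^2)^s\big)^{1/2}$, $\hat f_k=\int_{\mathbb T^2} f(x)e^{-ik\cdot x}\,dx$. Functions on $\mathbb T^2$ are identified with functions on $\mathbb R^2$ that are $2\pi$-periodic in each variable. Maps of $\mathbb T^2$ are given by their lifts to $\mathbb R^2$; in particular the implicit equation below, which involves the midpoint of two points, is an equation between points of $\mathbb R^2$. **Proposition.** There exists a constant $R_0>0$ such that the following holds for every integer $s\ge 3$, every real-valued $\omega_0\in H^s(\mathbb T^2)$ with average $0$, and every $\tau\in\,]0,1[$ with $\tau R_0\|\omega_0\|_{H^2(\mathbb T^2)}<1$. Let $\psi$ be the (continuous representative of the) solution with average $0$ of the Poisson equation $\Delta\psi=\omega_0$ on $\mathbb T^2$. i) For all $t\in[-\tau,\tau]$ and $x\in\mathbb R^2$ there exists a unique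 $\Phi_t(x)\in\mathbb R^2$ such that $$\Phi_t(x)=x+tJ\nabla\psi\Big(\frac{x+\Phi_t(x)}{2}\Big).$$ ii) The map $(t,x)\mapsto\Phi_t(x)$ is of class $C^{s-1}$ on $[-\tau,\tau]\times\mathbb R^2$. For every $t\in[-\tau,\tau]$, $\Phi_t$ induces a global $C^{s-1}$ diffeomorphism of $\mathbb T^2$, it is symplectic, i.e. $(\mathrm D_x\Phi_t(x))^\top J\,\mathrm D_x\Phi_t(x)=J$ for all $x$, and $\Phi_t^{-1}=\Phi_{-t}$. iii) For every $t\in[-\tau,\tau]$, the mappings $$\mathcal E_t(x)=x+\frac t2J\nabla\psi(x)\quad\text{and}\quad \mathcal E_t^*=\mathcal E_{-t}^{-1}$$ are well defined and induce global $C^{s-1}$ diffeomorphisms of $\mathbb T^2$ as well, and $\Phi_t=\mathcal E_t\circ\mathcal E_t^*$. iv) Let $V(t,x)=(\partial_t\Phi_{-t})(\Phi_t(x))$ for $t\in[-\tau,\tau]$ (the derivative in $t$ being taken at a fixed space point, and one-sided at $t=\pm\tau$). If $s\ge4$, there exists a vector field $(t,x)\mapsto\mathcal R(t,x)$ of class $C^{s-4}$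 on $[-\tau,\tau]\times\mathbb T^2$ such that, for all $t\in[-\tau,\tau]$ and all $x$, $$V(t,x)=-J\nabla\psi(x)+t^2\mathcal R(t,x).$$ -/

import Mathlib

open MeasureTheory Set Real
open scoped ContDiff Gradient InnerProductSpace

noncomputable section

namespace MidpointTorus

/-- The Euclidean plane, the universal cover of the torus. -/
abbrev Plane : Type := EuclideanSpace ℝ (Fin 2)

/-- The torus `(ℝ / 2πℤ)²`. -/
abbrev Torus : Type := Fin 2 → AddCircle (2 * π)

instance instFactTwoPiPos : Fact (0 < 2 * π) := ⟨Real.two_pi_pos⟩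

/-- The covering map `ℝ² → (ℝ / 2πℤ)²`. -/
def proj (x : Plane) : Torus := fun i => (x i : AddCircle (2 * π))

/-- The normalized Lebesgue measure on the torus (total mass one). -/
def torusMeasure : Measure Torus :=
  Measure.pi fun _ => (AddCircle.haarAddCircle : Measure (AddCircle (2 * π)))

/-- The Fourier coefficient `∫ f(x) exp(-i k·x) dx`; here `fourier n x = exp(i n x)`. -/
def fourierCoefficient (f : Torus → ℝ) (k : Fin 2 → ℤ) : ℂ :=
  ∫ x, (f x : ℂ) * ∏ i, fourier (-(k i)) (x i) ∂torusMeasure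

/-- The term `|f̂ₖ|² ⟨k⟩^{2s}` with `⟨k⟩² = 1 + k₁² + k₂²`. -/
def sobolevTerm (s : ℕ) (f : Torus → ℝ) (k : Fin 2 → ℤ) : ℝ :=
  ‖fourierCoefficient f k‖ ^ 2 * (1 + ((k 0 : ℝ) ^ 2 + (k 1 : ℝ) ^ 2)) ^ s

/-- Membership in the periodic Sobolev space `Hˢ` (real-valued functions). -/
def MemSobolev (s : ℕ) (f : Torus → ℝ) : Prop :=
  MemLp f 2 torusMeasure ∧ Summable (sobolevTerm s f)

/-- The norm `‖f‖_{Hˢ}` of a function `f` in `Hˢ`. -/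
def sobolevNorm (s : ℕ) (f : Torus → ℝ) : ℝ :=
  Real.sqrt (∑' k, sobolevTerm s f k)

/-- The Laplacian `∂₁²φ + ∂₂²φ` of a function on the torus, at the point `x`. -/
def torusLaplacian (φ : Torus → ℝ) (x : Torus) : ℝ :=
  Laplacian.laplacian (fun v : Plane => φ (x + proj v)) 0

/-- `ψ` is the solution with average zero of the Poisson equation `Δψ = f` on the torus. The
equation is understood in the sense of distributions, and `ψ` is the continuous function in its
almost-everywhere class. -/
structure IsPoissonSolution (f ψ : Torus → ℝ) : Prop where
  continuous : Continuous ψ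
  average_zero : ∫ x, ψ x ∂torusMeasure = 0
  weak_eq : ∀ φ : Torus → ℝ, ContDiff ℝ ∞ (fun v : Plane => φ (proj v)) →
    ∫ x, ψ x * torusLaplacian φ x ∂torusMeasure = ∫ x, f x * φ x ∂torusMeasure

/-- The canonical symplectic matrix. -/
def J : Matrix (Fin 2) (Fin 2) ℝ := !![0, 1; -1, 0]

/-- The Hamiltonian vector field `J∇ψ`, as a periodic vector field on the plane. -/
def hamiltonianField (ψ : Torus → ℝ) (x : Plane) : Plane :=
  Matrix.toEuclideanLin J (∇ (fun v : Plane => ψ (proj v)) x)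

/-- `y` solves the implicit midpoint equation `y = x + t J∇ψ((x + y)/2)` for the point `x`. -/
def IsMidpointStep (ψ : Torus → ℝ) (t : ℝ) (x y : Plane) : Prop :=
  y = x + t • hamiltonianField ψ ((1 / 2 : ℝ) • (x + y))

/-- The half-step explicit Euler map `ℰ_t(x) = x + (t/2) J∇ψ(x)`. -/
def eulerMap (ψ : Torus → ℝ) (t : ℝ) (x : Plane) : Plane :=
  x + (t / 2) • hamiltonianField ψ x

/-- The plane map `F` is a lift of a global `Cᵏ` diffeomorphism of the torus: it induces a
bijection `f` of the torus, `F` is `Cᵏ`, and `f⁻¹` has a `Cᵏ` lift `G`. -/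
def IsTorusDiffeo (k : ℕ) (F : Plane → Plane) : Prop :=
  ∃ f : Torus ≃ Torus,
    ContDiff ℝ k F ∧ (∀ x, proj (F x) = f (proj x)) ∧
    ∃ G : Plane → Plane, ContDiff ℝ k G ∧ ∀ x, proj (G x) = f.symm (proj x)

/-- The Jacobian matrix of `F` at `x`; its columns are the partial derivatives. -/
def jacobian (F : Plane → Plane) (x : Plane) : Matrix (Fin 2) (Fin 2) ℝ :=
  Matrix.of fun i j => fderiv ℝ F x (EuclideanSpace.single j 1) i

/-- `F` is symplectic: `(DF)ᵀ J DF = J` everywhere. -/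
def IsSymplectic (F : Plane → Plane) : Prop :=
  ∀ x, (jacobian F x).transpose * J * jacobian F x = J

end MidpointTorus

end

/-!
The Fourier coefficients of the weak solution `ψ` satisfy `|k|² ψ̂ₖ = -ω̂ₖ`: test the equation with
the real and imaginary parts of characters. By the Cauchy–Schwarz inequality
`∑ |k|ˢ |ψ̂ₖ| = ∑ |k|ˢ⁻² |ω̂ₖ|` is finite, because `∑ (1 + |k|²)⁻² < ∞` in dimension two. The Fourier
series of `ψ` therefore converges in `Cˢ`, the field `X = J∇ψ` is of class `Cˢ⁻¹`, and it is
Lipschitz with constant `K = C ‖ω₀‖_{H²} ≥ ∑ |ω̂ₖ|`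
(`IsPoissonSolution.lipschitzWith_hamiltonianField`).

The rest holds for any Lipschitz field `X` and times with `|t| K < 1`. In terms of the midpoint
`m = (x + y) / 2`, the equation `y = x + t X(m)` says `x = m - (t/2) X(m)` and `y = m + (t/2) X(m)`,
that is `x = ℰ₋ₜ(m)` and `y = ℰₜ(m)`. As `ℰ_{±t}` is a contractive perturbation of the identity it is
a bijection, so that `Φₜ = ℰₜ ∘ ℰ₋ₜ⁻¹`, which gives existence, uniqueness and `Φₜ⁻¹ = Φ₋ₜ`. The inverse
function theorem for `(t, m) ↦ (t, ℰ₋ₜ(m))` gives joint regularity up to the end points of the time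
interval, since the condition `|t| K < 1` is open (`contDiffAt_stepMidpoint`). In the plane, being
symplectic means having Jacobian determinant one, and as `DX` is trace free
`det Dℰₜ = 1 + (t²/4) det DX = det Dℰ₋ₜ` (`isSymplectic_midpointFlow`).

For the modified field, differentiating the implicit equation in time gives
`V = -X(m) - (t/2) DX(m) V` for `V(t, x) = (∂ₜΦ₋ₜ)(Φₜ(x))`, because the steps from `x` and back from
`Φₜ(x)` share the midpoint `m`. Inserting this identity into itself once, and subtracting the second
order Taylor expansion of `X(x) = X(m - (t/2) X(m))` at `m`, cancels the terms of order zero and one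
in `t` and leaves `t²` times a remainder that involves `D²X` only through an integral depending
smoothly on parameters (`neg_midpointVelocity_midpointFlow`).
-/

noncomputable section

namespace MidpointTorus

universe u

/-! ### Integrals depending smoothly on a parameter -/

/-- The two spaces live in the same universe because the induction on the order of
differentiability replaces `F` by `E →L[ℝ] F`. -/
theorem contDiff_parametric_intervalIntegral {E : Type u} [NormedAddCommGroup E] [NormedSpace ℝ E]
    [ProperSpace E] (n : ℕ) {F : Type u} [NormedAddCommGroup F] [NormedSpace ℝ F]
    (f : E × ℝ → F) (hf : ContDiff ℝ n f) (a b : ℝ) :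
    ContDiff ℝ n (fun x => ∫ θ in a..b, f (x, θ)) := by
  induction n generalizing F with
  | zero =>
    have hf0 : Continuous f := hf.continuous
    exact contDiff_zero.2
      (intervalIntegral.continuous_parametric_intervalIntegral_of_continuous'
        (f := fun x θ => f (x, θ)) hf0 a b)
  | succ n ih =>
    have hcont : Continuous f := hf.continuous
    have hg : ContDiff ℝ n (fun p : E × ℝ => (fderiv ℝ f p).comp (.inl ℝ E ℝ)) :=
      (hf.fderiv_right (by norm_cast)).clm_comp contDiff_const
    refine (contDiff_succ_iff_hasFDerivAt (n := n)).2 ⟨_, ih _ hg, fun x₀ => ?_⟩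
    obtain ⟨C, hC⟩ := ((isCompact_closedBall x₀ 1).prod isCompact_uIcc).exists_bound_of_continuousOn
      (f := fun p : E × ℝ => (fderiv ℝ f p).comp (.inl ℝ E ℝ))
      (s := Metric.closedBall x₀ 1 ×ˢ uIcc a b)
      hg.continuous.continuousOn
    refine intervalIntegral.hasFDerivAt_integral_of_dominated_of_fderiv_le
      (F := fun x θ => f (x, θ)) (F' := fun x θ => (fderiv ℝ f (x, θ)).comp (.inl ℝ E ℝ))
      (bound := fun _ => C) (s := Metric.closedBall x₀ 1)
      (Metric.closedBall_mem_nhds x₀ one_pos) ?_ ?_ ?_ ?_ ?_ ?_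
    · exact .of_forall fun x => (hcont.comp (by fun_prop)).aestronglyMeasurable
    · exact (hcont.comp (by fun_prop)).intervalIntegrable _ _
    · exact (hg.continuous.comp
        (by fun_prop : Continuous fun θ : ℝ => (x₀, θ))).aestronglyMeasurable
    · exact .of_forall fun θ hθ x hx => hC (x, θ) ⟨hx, uIoc_subset_uIcc hθ⟩
    · exact intervalIntegrable_const
    · refine .of_forall fun θ _ x _ => ?_
      have h1 : HasFDerivAt f (fderiv ℝ f (x, θ)) (x, θ) :=
        (hf.differentiable (by norm_cast)).differentiableAt.hasFDerivAt
      exact h1.comp x (hasFDerivAt_prodMk_left x θ)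

/-- Second order Taylor formula with integral remainder. -/
theorem taylor_two_integral {E F : Type*} [NormedAddCommGroup E] [NormedSpace ℝ E]
    [NormedAddCommGroup F] [NormedSpace ℝ F] [CompleteSpace F] {X : E → F} (hX : ContDiff ℝ 2 X)
    (m h : E) :
    X (m + h) = X m + fderiv ℝ X m h +
      ∫ θ in (0 : ℝ)..1, (1 - θ) • fderiv ℝ (fderiv ℝ X) (m + θ • h) h h := by
  have hX' : ContDiff ℝ 1 (fderiv ℝ X) := hX.fderiv_right (by norm_num)
  have hX'' : Continuous (fderiv ℝ (fderiv ℝ X)) := hX'.continuous_fderiv (by norm_num)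
  have hline (θ : ℝ) : HasDerivAt (fun θ : ℝ => m + θ • h) h θ := by
    simpa using ((hasDerivAt_id θ).smul_const h).const_add m
  have hd (θ : ℝ) : HasDerivAt
      (fun θ : ℝ => X (m + θ • h) + (1 - θ) • fderiv ℝ X (m + θ • h) h)
      ((1 - θ) • fderiv ℝ (fderiv ℝ X) (m + θ • h) h h) θ := by
    have h1 : HasDerivAt (fun θ : ℝ => X (m + θ • h)) (fderiv ℝ X (m + θ • h) h) θ :=
      (hX.differentiable (by norm_num)).differentiableAt.hasFDerivAt.comp_hasDerivAt θ (hline θ)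
    have h2 : HasDerivAt (fun θ : ℝ => fderiv ℝ X (m + θ • h) h)
        (fderiv ℝ (fderiv ℝ X) (m + θ • h) h h) θ := by
      have := ((hX'.differentiable (by norm_num)).differentiableAt
        (x := m + θ • h)).hasFDerivAt.comp_hasDerivAt θ (hline θ)
      simpa using this.clm_apply (hasDerivAt_const θ h)
    have h3 := h1.add ((((hasDerivAt_id θ).const_sub 1)).smul h2)
    convert h3 using 1
    · ext θ; simp
    · simp only [id]; module
  have := intervalIntegral.integral_eq_sub_of_hasDerivAt (fun θ _ => hd θ)
    (((by fun_prop : Continuous fun θ : ℝ =>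
      (1 - θ) • fderiv ℝ (fderiv ℝ X) (m + θ • h) h h)).intervalIntegrable 0 1)
  rw [this]
  simp

/-! ### The implicit midpoint rule for a Lipschitz vector field -/

section MidpointRule

variable {E : Type u} [NormedAddCommGroup E] [NormedSpace ℝ E]

/-- The explicit Euler step `x ↦ x + (t/2) X(x)` of length `t / 2`. -/
def halfStep (X : E → E) (t : ℝ) (x : E) : E := x + (t / 2) • X x

/-- The midpoint of the implicit midpoint step from `x`: the solution `m` of `m - (t/2) X(m) = x`.
It is given by an inverse function, and is meaningful when `halfStep X (-t)` is bijective. -/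
def stepMidpoint (X : E → E) (t : ℝ) (x : E) : E := Function.invFun (halfStep X (-t)) x

/-- The implicit midpoint step of length `t`, an implicit half step followed by an explicit one. -/
def midpointFlow (X : E → E) (t : ℝ) (x : E) : E := halfStep X t (stepMidpoint X t x)

variable {X : E → E} {K : NNReal} {t : ℝ}

theorem contractingWith_halfStep (hX : LipschitzWith K X) (ht : |t| * K < 1) (x : E) :
    ContractingWith (‖t / 2‖₊ * K) (fun m => x + (t / 2) • X m) := by
  refine ⟨?_, ?_⟩
  · rw [← NNReal.coe_lt_coe]
    have : 0 ≤ |t| * K := by positivity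
    simp
    linarith
  · simpa using (LipschitzWith.const x).add ((lipschitzWith_smul (t / 2)).comp hX)

theorem halfStep_injective (hX : LipschitzWith K X) (ht : |t| * K < 1) :
    Function.Injective (halfStep X t) := by
  intro x y h
  have ht' : |-t| * K < 1 := by rwa [abs_neg]
  have hc := contractingWith_halfStep hX ht' (halfStep X t x)
  refine hc.fixedPoint_unique' (x := x) (y := y) ?_ ?_
  · simp only [Function.IsFixedPt, halfStep]; module
  · simp only [Function.IsFixedPt, h]; simp only [halfStep]; module

theorem halfStep_surjective [CompleteSpace E] (hX : LipschitzWith K X) (ht : |t| * K < 1) :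
    Function.Surjective (halfStep X t) := by
  intro x
  have ht' : |-t| * K < 1 := by rwa [abs_neg]
  have hc := contractingWith_halfStep hX ht' x
  refine ⟨ContractingWith.fixedPoint _ hc, ?_⟩
  have : x + (-t / 2) • X (ContractingWith.fixedPoint _ hc) = ContractingWith.fixedPoint _ hc :=
    hc.fixedPoint_isFixedPt
  simp only [halfStep]
  nth_rw 1 [← this]
  module

theorem halfStep_neg_stepMidpoint [CompleteSpace E] (hX : LipschitzWith K X) (ht : |t| * K < 1)
    (x : E) : halfStep X (-t) (stepMidpoint X t x) = x :=
  Function.rightInverse_invFun (halfStep_surjective hX (by rwa [abs_neg])) x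

theorem stepMidpoint_halfStep_neg (hX : LipschitzWith K X) (ht : |t| * K < 1) (x : E) :
    stepMidpoint X t (halfStep X (-t) x) = x :=
  Function.leftInverse_invFun (halfStep_injective hX (by rwa [abs_neg])) x

theorem stepMidpoint_eq_iff [CompleteSpace E] (hX : LipschitzWith K X) (ht : |t| * K < 1)
    {x m : E} : m = stepMidpoint X t x ↔ halfStep X (-t) m = x := by
  constructor
  · rintro rfl; exact halfStep_neg_stepMidpoint hX ht x
  · rintro rfl; exact (stepMidpoint_halfStep_neg hX ht m).symm

theorem midpoint_midpointFlow [CompleteSpace E] (hX : LipschitzWith K X) (ht : |t| * K < 1)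
    (x : E) : (1 / 2 : ℝ) • (x + midpointFlow X t x) = stepMidpoint X t x := by
  have := halfStep_neg_stepMidpoint hX ht x
  simp only [midpointFlow, halfStep] at *
  nth_rw 1 [← this]
  module

/-- The implicit midpoint equation has exactly one solution. -/
theorem midpoint_equation_iff [CompleteSpace E] (hX : LipschitzWith K X) (ht : |t| * K < 1)
    {x y : E} : y = x + t • X ((1 / 2 : ℝ) • (x + y)) ↔ y = midpointFlow X t x := by
  constructor
  · intro h
    have hm : (1 / 2 : ℝ) • (x + y) = stepMidpoint X t x := by
      rw [stepMidpoint_eq_iff hX ht]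
      simp only [halfStep]
      nth_rw 1 [h]
      module
    rw [midpointFlow, ← hm]
    simp only [halfStep]
    nth_rw 1 [h]
    nth_rw 2 [h]
    module
  · rintro rfl
    rw [midpoint_midpointFlow hX ht]
    have := halfStep_neg_stepMidpoint hX ht x
    nth_rw 2 [← this]
    simp only [midpointFlow, halfStep]
    module

theorem stepMidpoint_neg_midpointFlow (hX : LipschitzWith K X) (ht : |t| * K < 1) (x : E) :
    stepMidpoint X (-t) (midpointFlow X t x) = stepMidpoint X t x := by
  have := stepMidpoint_halfStep_neg (t := -t) hX (by rwa [abs_neg]) (stepMidpoint X t x)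
  rwa [neg_neg] at this

theorem midpointFlow_neg_midpointFlow [CompleteSpace E] (hX : LipschitzWith K X)
    (ht : |t| * K < 1) (x : E) : midpointFlow X (-t) (midpointFlow X t x) = x := by
  rw [midpointFlow, stepMidpoint_neg_midpointFlow hX ht, halfStep_neg_stepMidpoint hX ht]

theorem halfStep_add_period {p : E} (hp : ∀ x, X (x + p) = X x) (t : ℝ) (x : E) :
    halfStep X t (x + p) = halfStep X t x + p := by
  simp only [halfStep, hp]; abel

theorem stepMidpoint_add_period [CompleteSpace E] (hX : LipschitzWith K X) (ht : |t| * K < 1)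
    {p : E} (hp : ∀ x, X (x + p) = X x) (x : E) :
    stepMidpoint X t (x + p) = stepMidpoint X t x + p := by
  symm
  rw [stepMidpoint_eq_iff hX ht, halfStep_add_period hp, halfStep_neg_stepMidpoint hX ht]

theorem midpointFlow_add_period [CompleteSpace E] (hX : LipschitzWith K X) (ht : |t| * K < 1)
    {p : E} (hp : ∀ x, X (x + p) = X x) (x : E) :
    midpointFlow X t (x + p) = midpointFlow X t x + p := by
  rw [midpointFlow, stepMidpoint_add_period hX ht hp, halfStep_add_period hp, midpointFlow]

/-- Times for which the half steps are contractive perturbations of the identity. The set is open,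
so that it is a neighbourhood of each closed time interval that it contains. -/
def admissibleTimes (K : NNReal) : Set ℝ := {t | |t| * K < 1}

theorem isOpen_admissibleTimes (K : NNReal) : IsOpen (admissibleTimes K) :=
  isOpen_lt (by fun_prop) continuous_const

theorem contDiff_halfStep {n : ℕ} (hXn : ContDiff ℝ n X) :
    ContDiff ℝ n (fun p : ℝ × E => halfStep X p.1 p.2) := by
  unfold halfStep
  have := hXn.comp (contDiff_snd : ContDiff ℝ n (Prod.snd : ℝ × E → E))
  exact contDiff_snd.add ((contDiff_fst.div_const 2).smul this)

theorem hasFDerivAt_halfStep (hXd : Differentiable ℝ X) (t : ℝ) (x : E) :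
    HasFDerivAt (halfStep X t) (.id ℝ E + (t / 2) • fderiv ℝ X x) x :=
  (hasFDerivAt_id x).add (hXd.differentiableAt.hasFDerivAt.const_smul _)

/-- The midpoint depends smoothly on time and position: `(t, m) ↦ (t, m - (t/2) X(m))` is injective
and has invertible derivative, so that the inverse function theorem applies. -/
theorem contDiffAt_stepMidpoint [FiniteDimensional ℝ E] {n : ℕ} (hn : n ≠ 0)
    (hX : LipschitzWith K X) (hXn : ContDiff ℝ n X) {t : ℝ} (ht : t ∈ admissibleTimes K) (x : E) :
    ContDiffAt ℝ n (fun p : ℝ × E => stepMidpoint X p.1 p.2) (t, x) := by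
  have : CompleteSpace E := FiniteDimensional.complete ℝ E
  have hn' : (n : WithTop ℕ∞) ≠ 0 := by exact_mod_cast hn
  set G : ℝ × E → ℝ × E := fun p => (p.1, halfStep X (-p.1) p.2) with hG
  set m := stepMidpoint X t x
  have hGn : ContDiff ℝ n G := contDiff_fst.prodMk
    ((contDiff_halfStep hXn).comp (contDiff_fst.neg.prodMk contDiff_snd))
  have hGm : G (t, m) = (t, x) := by simp [hG, m, halfStep_neg_stepMidpoint hX ht]
  have hGd : HasFDerivAt G (fderiv ℝ G (t, m)) (t, m) :=
    (hGn.differentiable hn').differentiableAt.hasFDerivAt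
  -- a kernel vector `(a, v)` has `a = 0` and `v = (t/2) DX(m) v`, hence `‖v‖ ≤ (1/2) ‖v‖`
  have hinj : Function.Injective (fderiv ℝ G (t, m)) := by
    rw [injective_iff_map_eq_zero]
    rintro ⟨a, v⟩ h0
    have ha : a = 0 := by
      have h1 := (hasFDerivAt_fst (𝕜 := ℝ) (p := G (t, m))).comp (t, m) hGd
      have h2 : HasFDerivAt (Prod.fst ∘ G) (.fst ℝ ℝ E) (t, m) := hasFDerivAt_fst
      have h3 := congrArg (fun L => L (a, v)) (h1.unique h2)
      simpa [h0] using h3.symm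
    subst ha
    have h1 : HasFDerivAt (fun y : E => G (t, y)) _ m := hGd.comp m (hasFDerivAt_prodMk_right t m)
    have h2 := (hasFDerivAt_snd (𝕜 := ℝ) (p := G (t, m))).comp m h1
    have h3 := h2.unique (hasFDerivAt_halfStep (hXn.differentiable hn') (-t) m)
    have h4 := congrArg (fun L => L v) h3
    simp [h0] at h4
    have h5 : v = (t / 2) • fderiv ℝ X m v := by
      have : v - (t / 2) • fderiv ℝ X m v = 0 := by rw [h4]; module
      exact sub_eq_zero.1 this
    have h6 : ‖v‖ ≤ |t| / 2 * (K * ‖v‖) := by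
      conv_lhs => rw [h5]
      rw [norm_smul]
      have := (fderiv ℝ X m).le_of_opNorm_le (norm_fderiv_le_of_lipschitz ℝ hX) v
      rw [norm_div, Real.norm_eq_abs, Real.norm_two]
      gcongr
    have h7 : |t| * K < 1 := ht
    have : v = 0 := by
      by_contra hv
      have : 0 < ‖v‖ := norm_pos_iff.2 hv
      nlinarith
    simp [this]
  let L : (ℝ × E) ≃L[ℝ] (ℝ × E) :=
    (LinearEquiv.ofInjectiveEndo (fderiv ℝ G (t, m)).toLinearMap hinj).toContinuousLinearEquiv
  have hGL : HasFDerivAt G (L : (ℝ × E) →L[ℝ] (ℝ × E)) (t, m) := by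
    convert hGd using 1
    ext p <;> rfl
  have hloc := hGn.contDiffAt.to_localInverse hGL hn'
  have hstrict := hGn.contDiffAt.hasStrictFDerivAt' hGL hn'
  -- near `(t, x)` the local inverse of `G` agrees with the global one, as `G` preserves time
  have hri := hstrict.eventually_right_inverse
  rw [hGm] at hloc hri
  refine (contDiff_snd.contDiffAt.comp (t, x) hloc).congr_of_eventuallyEq ?_
  have hU : ∀ᶠ p : ℝ × E in nhds (t, x), p.1 ∈ admissibleTimes K :=
    continuous_fst.continuousAt.eventually ((isOpen_admissibleTimes K).mem_nhds ht)
  filter_upwards [hri, hU] with p hp hpU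
  set q := hstrict.localInverse G L (t, m) p
  have h1 : (G q).1 = p.1 := by rw [hp]
  have h2 : (G q).2 = p.2 := by rw [hp]
  simp only [hG] at h1 h2
  rw [h1] at h2
  exact ((stepMidpoint_eq_iff hX hpU).2 h2).symm

theorem contDiffAt_midpointFlow [FiniteDimensional ℝ E] {n : ℕ} (hn : n ≠ 0)
    (hX : LipschitzWith K X) (hXn : ContDiff ℝ n X) {t : ℝ} (ht : t ∈ admissibleTimes K) (x : E) :
    ContDiffAt ℝ n (fun p : ℝ × E => midpointFlow X p.1 p.2) (t, x) :=
  ((contDiff_halfStep hXn).contDiffAt).comp (t, x)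
    (contDiffAt_fst.prodMk (contDiffAt_stepMidpoint hn hX hXn ht x))

end MidpointRule

/-! ### The modified vector field of the implicit midpoint rule -/

section ModifiedField

variable {E : Type u} [NormedAddCommGroup E] [NormedSpace ℝ E] {X : E → E} {K : NNReal}

/-- The time derivative `∂ₜ Φₜ(x)` of the implicit midpoint step. -/
def midpointVelocity (X : E → E) (t : ℝ) (x : E) : E :=
  fderiv ℝ (fun p : ℝ × E => midpointFlow X p.1 p.2) (t, x) (1, 0)

theorem hasDerivAt_midpointFlow [FiniteDimensional ℝ E] (hX : LipschitzWith K X)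
    (hX1 : ContDiff ℝ 1 X) {t : ℝ} (ht : t ∈ admissibleTimes K) (x : E) :
    HasDerivAt (fun r => midpointFlow X r x) (midpointVelocity X t x) t := by
  have h := (contDiffAt_midpointFlow (n := 1) one_ne_zero hX (by exact_mod_cast hX1) ht x)
    |>.differentiableAt (by norm_num) |>.hasFDerivAt
  exact h.comp_hasDerivAt t ((hasDerivAt_id t).prodMk (hasDerivAt_const t x))

/-- The implicit midpoint equation, differentiated in time. -/
theorem midpointVelocity_eq [FiniteDimensional ℝ E] (hX : LipschitzWith K X)
    (hX1 : ContDiff ℝ 1 X) {t : ℝ} (ht : t ∈ admissibleTimes K) (x : E) :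
    midpointVelocity X t x = X (stepMidpoint X t x) +
      (t / 2) • fderiv ℝ X (stepMidpoint X t x) (midpointVelocity X t x) := by
  have : CompleteSpace E := FiniteDimensional.complete ℝ E
  have h := hasDerivAt_midpointFlow hX hX1 ht x
  have hm : HasDerivAt (fun r => (1 / 2 : ℝ) • (x + midpointFlow X r x))
      ((1 / 2 : ℝ) • midpointVelocity X t x) t := (h.const_add x).const_smul _
  have hXd := ((hX1.differentiable (by norm_num)).differentiableAt
    (x := (1 / 2 : ℝ) • (x + midpointFlow X t x))).hasFDerivAt
  have h2 : HasDerivAt (fun r => x + r • X ((1 / 2 : ℝ) • (x + midpointFlow X r x))) _ t :=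
    ((hasDerivAt_id t).smul (hXd.comp_hasDerivAt t hm)).const_add x
  have h3 := h2.congr_of_eventuallyEq (f₁ := fun r => midpointFlow X r x) (by
    filter_upwards [(isOpen_admissibleTimes K).mem_nhds ht] with r hr
    exact (midpoint_equation_iff hX hr).2 rfl)
  have h4 := h.unique h3
  simp only [midpoint_midpointFlow hX ht, Function.comp, id, map_smul] at h4
  conv_lhs => rw [h4]
  module

/-- The remainder `ℛ` in `(∂ₜΦ₋ₜ) ∘ Φₜ = -X + t² ℛ`. With `m` the midpoint of the step from `x`, so
that `x = m - (t/2) X(m)`, it is made of the second order Taylor remainder of `X` between `m` and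
`x`, and of the second order term of the Neumann series of `(1 + (t/2) DX(m))⁻¹`. -/
def modifiedFieldRemainder (X : E → E) (t : ℝ) (x : E) : E :=
  (1 / 4 : ℝ) • ((∫ θ in (0 : ℝ)..1, (1 - θ) •
      fderiv ℝ (fderiv ℝ X) (stepMidpoint X t x + θ • -((t / 2) • X (stepMidpoint X t x)))
        (X (stepMidpoint X t x)) (X (stepMidpoint X t x))) -
    fderiv ℝ X (stepMidpoint X t x) (fderiv ℝ X (stepMidpoint X t x)
      (midpointVelocity X (-t) (midpointFlow X t x))))

theorem neg_mem_admissibleTimes {t : ℝ} (ht : t ∈ admissibleTimes K) : -t ∈ admissibleTimes K := by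
  simpa [admissibleTimes] using ht

/-- The expansion of the modified field: with `v = -V`, the equation `v = X(m) - (t/2) DX(m) v` of
`midpointVelocity_eq` is used twice, and compared with the Taylor expansion of `X(x)` at `m`. -/
theorem neg_midpointVelocity_midpointFlow [FiniteDimensional ℝ E] (hX : LipschitzWith K X)
    (hX2 : ContDiff ℝ 2 X) {t : ℝ} (ht : t ∈ admissibleTimes K) (x : E) :
    -midpointVelocity X (-t) (midpointFlow X t x) =
      -X x + t ^ 2 • modifiedFieldRemainder X t x := by
  have : CompleteSpace E := FiniteDimensional.complete ℝ E
  have hv := midpointVelocity_eq hX (hX2.of_le (by norm_num)) (neg_mem_admissibleTimes ht)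
    (midpointFlow X t x)
  have hx : x = stepMidpoint X t x + -((t / 2) • X (stepMidpoint X t x)) := by
    conv_lhs => rw [← halfStep_neg_stepMidpoint hX ht x]
    simp only [halfStep]; module
  have htay := taylor_two_integral hX2 (stepMidpoint X t x)
    (-((t / 2) • X (stepMidpoint X t x)))
  rw [← hx] at htay
  rw [stepMidpoint_neg_midpointFlow hX ht] at hv
  rw [modifiedFieldRemainder]
  set m := stepMidpoint X t x
  set v := midpointVelocity X (-t) (midpointFlow X t x)
  have hint : (∫ θ in (0 : ℝ)..1, (1 - θ) • fderiv ℝ (fderiv ℝ X) (m + θ • -((t / 2) • X m))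
      (-((t / 2) • X m)) (-((t / 2) • X m))) = (t / 2) ^ 2 •
      ∫ θ in (0 : ℝ)..1,
        (1 - θ) • fderiv ℝ (fderiv ℝ X) (m + θ • -((t / 2) • X m)) (X m) (X m) := by
    rw [← intervalIntegral.integral_smul]
    congr 1
    ext θ
    simp only [map_neg, map_smul, neg_apply, smul_apply]
    module
  rw [hint] at htay
  rw [htay]
  have hv2 : fderiv ℝ X m v = fderiv ℝ X m (X m) + (-t / 2) • fderiv ℝ X m (fderiv ℝ X m v) := by
    conv_lhs => rw [hv]
    rw [map_add, map_smul]
  conv_lhs => rw [hv, hv2]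
  simp only [map_neg, map_smul]
  module

theorem hasDerivAt_midpointFlow_neg [FiniteDimensional ℝ E] (hX : LipschitzWith K X)
    (hX2 : ContDiff ℝ 2 X) {t : ℝ} (ht : t ∈ admissibleTimes K) (x : E) :
    HasDerivAt (fun r => midpointFlow X (-r) (midpointFlow X t x))
      (-X x + t ^ 2 • modifiedFieldRemainder X t x) t := by
  rw [← neg_midpointVelocity_midpointFlow hX hX2 ht]
  have h := hasDerivAt_midpointFlow hX (hX2.of_le (by norm_num)) (neg_mem_admissibleTimes ht)
    (midpointFlow X t x)
  simpa using! h.scomp t (hasDerivAt_neg t)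

theorem contDiffAt_midpointVelocity [FiniteDimensional ℝ E] {n : ℕ} (hX : LipschitzWith K X)
    (hXn : ContDiff ℝ (n + 1 : ℕ) X) {t : ℝ} (ht : t ∈ admissibleTimes K) (x : E) :
    ContDiffAt ℝ n (fun p : ℝ × E => midpointVelocity X p.1 p.2) (t, x) :=
  ((contDiffAt_midpointFlow n.succ_ne_zero hX hXn ht x).fderiv_right
    (by norm_cast)).clm_apply contDiffAt_const

theorem contDiffAt_modifiedFieldRemainder [FiniteDimensional ℝ E] {n : ℕ}
    (hX : LipschitzWith K X) (hXn : ContDiff ℝ (n + 2 : ℕ) X) {t : ℝ}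
    (ht : t ∈ admissibleTimes K) (x : E) :
    ContDiffAt ℝ n (fun p : ℝ × E => modifiedFieldRemainder X p.1 p.2) (t, x) := by
  have hX0 : ContDiff ℝ n X := hXn.of_le (by norm_cast; omega)
  have hD1 : ContDiff ℝ (n + 1 : ℕ) (fderiv ℝ X) := hXn.fderiv_right (by norm_cast)
  have hD0 : ContDiff ℝ n (fderiv ℝ X) := hD1.of_le (by norm_cast; omega)
  have hD2 : ContDiff ℝ n (fderiv ℝ (fderiv ℝ X)) := hD1.fderiv_right (by norm_cast)
  have hm : ContDiffAt ℝ n (fun p : ℝ × E => stepMidpoint X p.1 p.2) (t, x) :=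
    (contDiffAt_stepMidpoint (n := n + 2) (by omega) hX hXn ht x).of_le (by norm_cast; omega)
  have hΦ : ContDiffAt ℝ n (fun p : ℝ × E => midpointFlow X p.1 p.2) (t, x) :=
    (contDiffAt_midpointFlow (n := n + 2) (by omega) hX hXn ht x).of_le (by norm_cast; omega)
  have hv : ContDiffAt ℝ n
      (fun p : ℝ × E => midpointVelocity X (-p.1) (midpointFlow X p.1 p.2)) (t, x) :=
    ContDiffAt.comp (t, x) (f := fun p : ℝ × E => (-p.1, midpointFlow X p.1 p.2))
      (g := fun p : ℝ × E => midpointVelocity X p.1 p.2)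
      (contDiffAt_midpointVelocity hX (hXn.of_le (by norm_cast; omega))
        (neg_mem_admissibleTimes ht) (midpointFlow X t x)) (contDiffAt_fst.neg.prodMk hΦ)
  have hI : ContDiff ℝ n (fun q : ℝ × E => ∫ θ in (0 : ℝ)..1, (1 - θ) •
      fderiv ℝ (fderiv ℝ X) (q.2 + θ • -((q.1 / 2) • X q.2)) (X q.2) (X q.2)) := by
    refine contDiff_parametric_intervalIntegral n (fun q : (ℝ × E) × ℝ => (1 - q.2) •
      fderiv ℝ (fderiv ℝ X) (q.1.2 + q.2 • -((q.1.1 / 2) • X q.1.2)) (X q.1.2) (X q.1.2)) ?_ 0 1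
    fun_prop
  have hA := hD0.contDiffAt.comp (t, x) hm
  exact ((hI.contDiffAt.comp (t, x) (contDiffAt_fst.prodMk hm)).sub
    (hA.clm_apply (hA.clm_apply hv))).const_smul _

theorem midpointVelocity_add_period [FiniteDimensional ℝ E] (hX : LipschitzWith K X)
    (hX1 : ContDiff ℝ 1 X) {p : E} (hp : ∀ x, X (x + p) = X x) {t : ℝ}
    (ht : t ∈ admissibleTimes K) (x : E) :
    midpointVelocity X t (x + p) = midpointVelocity X t x := by
  have : CompleteSpace E := FiniteDimensional.complete ℝ E
  have h1 := hasDerivAt_midpointFlow hX hX1 ht (x + p)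
  have h2 := (hasDerivAt_midpointFlow hX hX1 ht x).add_const p
  refine h1.unique (h2.congr_of_eventuallyEq ?_)
  filter_upwards [(isOpen_admissibleTimes K).mem_nhds ht] with r hr
  exact midpointFlow_add_period hX hr hp x

theorem modifiedFieldRemainder_add_period [FiniteDimensional ℝ E] (hX : LipschitzWith K X)
    (hX1 : ContDiff ℝ 1 X) {p : E} (hp : ∀ x, X (x + p) = X x) {t : ℝ}
    (ht : t ∈ admissibleTimes K) (x : E) :
    modifiedFieldRemainder X t (x + p) = modifiedFieldRemainder X t x := by
  have : CompleteSpace E := FiniteDimensional.complete ℝ E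
  have hD (y : E) : fderiv ℝ X (y + p) = fderiv ℝ X y := by
    rw [← fderiv_comp_add_right]; simp only [hp]
  have hD2 (y : E) : fderiv ℝ (fderiv ℝ X) (y + p) = fderiv ℝ (fderiv ℝ X) y := by
    rw [← fderiv_comp_add_right]; simp only [hD]
  simp only [modifiedFieldRemainder, stepMidpoint_add_period hX ht hp,
    midpointFlow_add_period hX ht hp, hp, hD, add_right_comm _ p, hD2,
    midpointVelocity_add_period hX hX1 hp (neg_mem_admissibleTimes ht)]

end ModifiedField

/-! ### Fourier series on the torus -/

/-- The integer frequency `k`, as a vector of the plane. -/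
def frequency (k : Fin 2 → ℤ) : Plane := WithLp.toLp 2 fun i => (k i : ℝ)

theorem norm_sq_frequency (k : Fin 2 → ℤ) :
    ‖frequency k‖ ^ 2 = (k 0 : ℝ) ^ 2 + (k 1 : ℝ) ^ 2 := by
  simp [EuclideanSpace.norm_sq_eq, frequency, Fin.sum_univ_two]

theorem one_le_norm_frequency {k : Fin 2 → ℤ} (hk : k ≠ 0) : 1 ≤ ‖frequency k‖ := by
  have h : 1 ≤ (k 0) ^ 2 + (k 1) ^ 2 := by
    by_contra! h
    have h0 : (k 0) ^ 2 = 0 := by nlinarith [sq_nonneg (k 0), sq_nonneg (k 1)]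
    have h1 : (k 1) ^ 2 = 0 := by nlinarith [sq_nonneg (k 0), sq_nonneg (k 1)]
    apply hk
    ext i
    fin_cases i
    · simpa using h0
    · simpa using h1
  have h2 : (1 : ℝ) ≤ ‖frequency k‖ ^ 2 := by
    rw [norm_sq_frequency]; exact_mod_cast h
  nlinarith [norm_nonneg (frequency k)]

/-- The character `x ↦ exp(i k·x)` of the torus. -/
def character (k : Fin 2 → ℤ) (x : Torus) : ℂ := ∏ i, fourier (k i) (x i)

theorem continuous_character (k : Fin 2 → ℤ) : Continuous (character k) := by
  unfold character; fun_prop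

theorem character_proj (k : Fin 2 → ℤ) (v : Plane) :
    character k (proj v) = Complex.exp ((⟪frequency k, v⟫_ℝ : ℝ) * Complex.I) := by
  have hπ : (π : ℂ) ≠ 0 := by exact_mod_cast Real.pi_ne_zero
  simp only [character, proj, Fin.prod_univ_two, fourier_coe_apply, ← Complex.exp_add]
  congr 1
  simp [frequency, PiLp.inner_apply, Fin.sum_univ_two]
  field_simp

theorem norm_character (k : Fin 2 → ℤ) (x : Torus) : ‖character k x‖ = 1 := by
  simp only [character, norm_prod, fourier_apply, Circle.norm_coe, Finset.prod_const_one]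

theorem fourierCoefficient_eq (f : Torus → ℝ) (k : Fin 2 → ℤ) :
    fourierCoefficient f k = ∫ x, (f x : ℂ) * character (-k) x ∂torusMeasure := rfl

theorem proj_surjective : Function.Surjective proj := by
  intro x
  choose v hv using fun i => QuotientAddGroup.mk_surjective (x i)
  exact ⟨WithLp.toLp 2 v, funext hv⟩

theorem proj_add (v w : Plane) : proj (v + w) = proj v + proj w := by
  ext i; simp [proj]

theorem proj_sub (v w : Plane) : proj (v - w) = proj v - proj w := by
  ext i; simp [proj]

instance instIsProbabilityMeasureTorusMeasure : IsProbabilityMeasure torusMeasure := by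
  unfold torusMeasure; infer_instance

/-- The rescaling `(ℝ / ℤ)² ≃ (ℝ / 2πℤ)²`. -/
def unitTorusHomeomorph : UnitAddTorus (Fin 2) ≃ₜ Torus :=
  Homeomorph.piCongrRight fun _ =>
    AddCircle.homeomorphAddCircle 1 (2 * π) one_ne_zero Real.two_pi_pos.ne'

theorem measurePreserving_unitTorusHomeomorph :
    MeasurePreserving unitTorusHomeomorph
      (Measure.pi fun _ => (AddCircle.haarAddCircle : Measure UnitAddCircle)) torusMeasure := by
  refine measurePreserving_pi _ _ fun _ => ?_
  exact AddMonoidHom.measurePreserving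
    (f := (AddCircle.equivAddCircle 1 (2 * π) one_ne_zero Real.two_pi_pos.ne').toAddMonoidHom)
    (AddCircle.homeomorphAddCircle 1 (2 * π) one_ne_zero Real.two_pi_pos.ne').continuous
    (AddCircle.equivAddCircle 1 (2 * π) one_ne_zero Real.two_pi_pos.ne').surjective
    (by simp)

theorem character_unitTorusHomeomorph (k : Fin 2 → ℤ) (x : UnitAddTorus (Fin 2)) :
    character k (unitTorusHomeomorph x) = UnitAddTorus.mFourier k x := by
  have hπ : (π : ℂ) ≠ 0 := by exact_mod_cast Real.pi_ne_zero
  change ∏ i, _ = ∏ i, fourier (k i) (x i)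
  refine Finset.prod_congr rfl fun i _ => ?_
  change fourier (k i) (AddCircle.homeomorphAddCircle 1 (2 * π) one_ne_zero
    Real.two_pi_pos.ne' (x i)) = _
  obtain ⟨y, hy⟩ := QuotientAddGroup.mk_surjective (x i)
  rw [← hy, AddCircle.homeomorphAddCircle_apply_mk, fourier_coe_apply, fourier_coe_apply]
  congr 1
  push_cast
  field_simp

/-- A continuous function with summable Fourier coefficients is the sum of its Fourier series. -/
theorem hasSum_fourierCoefficient {f : Torus → ℝ} (hf : Continuous f)
    (hs : Summable fun k => ‖fourierCoefficient f k‖) (x : Torus) :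
    HasSum (fun k => (fourierCoefficient f k * character k x).re) (f x) := by
  let g : C(UnitAddTorus (Fin 2), ℂ) :=
    ⟨fun y => (f (unitTorusHomeomorph y) : ℂ), by fun_prop⟩
  have hcoef : UnitAddTorus.mFourierCoeff g = fourierCoefficient f := by
    ext k
    rw [fourierCoefficient_eq, ← measurePreserving_unitTorusHomeomorph.integral_comp
      unitTorusHomeomorph.measurableEmbedding]
    refine integral_congr_ae (.of_forall fun y => ?_)
    simp only [character_unitTorusHomeomorph, smul_eq_mul]
    exact mul_comm _ _
  have h := UnitAddTorus.hasSum_mFourier_series_apply_of_summable (f := g)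
    (by rw [hcoef]; exact hs.of_norm) (unitTorusHomeomorph.symm x)
  rw [hcoef] at h
  simpa [g, ← character_unitTorusHomeomorph] using Complex.hasSum_re h

/-! ### The Poisson equation in Fourier variables -/

/-- The Laplacian of a plane wave `v ↦ g(κ·(w + v))` at the origin. -/
theorem laplacian_plane_wave {g g' g'' : ℝ → ℝ} (hg : ∀ s, HasDerivAt g (g' s) s)
    (hg' : ∀ s, HasDerivAt g' (g'' s) s) (κ w : Plane) :
    Laplacian.laplacian (fun v : Plane => g ⟪κ, w + v⟫_ℝ) 0 = ‖κ‖ ^ 2 * g'' ⟪κ, w⟫_ℝ := by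
  have hin (v : Plane) : HasFDerivAt (fun v : Plane => ⟪κ, w + v⟫_ℝ) (innerSL ℝ κ) v :=
    (innerSL ℝ κ).hasFDerivAt.comp v ((hasFDerivAt_id v).const_add w)
  have h1 : fderiv ℝ (fun v : Plane => g ⟪κ, w + v⟫_ℝ) =
      fun v => g' ⟪κ, w + v⟫_ℝ • innerSL ℝ κ := by
    ext1 v
    exact ((hg _).comp_hasFDerivAt v (hin v)).fderiv
  have h2 : fderiv ℝ (fderiv ℝ (fun v : Plane => g ⟪κ, w + v⟫_ℝ)) 0 =
      (g'' ⟪κ, w⟫_ℝ • innerSL ℝ κ).smulRight (innerSL ℝ κ) := by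
    rw [h1]
    have := ((hg' _).comp_hasFDerivAt 0 (hin 0)).smul_const (innerSL ℝ κ)
    simpa using this.fderiv
  rw [InnerProductSpace.laplacian_eq_iteratedFDeriv_orthonormalBasis _
    (EuclideanSpace.basisFun (Fin 2) ℝ)]
  simp only [iteratedFDeriv_two_apply, h2]
  simp [EuclideanSpace.norm_sq_eq, Fin.sum_univ_two, EuclideanSpace.inner_single_right]
  ring

theorem torusLaplacian_re_character (k : Fin 2 → ℤ) (x : Torus) :
    torusLaplacian (fun y => (character k y).re) x = -‖frequency k‖ ^ 2 * (character k x).re := by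
  obtain ⟨w, rfl⟩ := proj_surjective x
  simp only [torusLaplacian, ← proj_add, character_proj, Complex.exp_ofReal_mul_I_re]
  rw [laplacian_plane_wave (g'' := fun s => -Real.cos s) Real.hasDerivAt_cos
    (fun s => (Real.hasDerivAt_sin s).neg)]
  ring

theorem torusLaplacian_im_character (k : Fin 2 → ℤ) (x : Torus) :
    torusLaplacian (fun y => (character k y).im) x = -‖frequency k‖ ^ 2 * (character k x).im := by
  obtain ⟨w, rfl⟩ := proj_surjective x
  simp only [torusLaplacian, ← proj_add, character_proj, Complex.exp_ofReal_mul_I_im]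
  rw [laplacian_plane_wave (g'' := fun s => -Real.sin s) Real.hasDerivAt_sin
    Real.hasDerivAt_cos]
  ring

theorem integrable_mul_character {f : Torus → ℝ} (hf : Integrable f torusMeasure)
    (k : Fin 2 → ℤ) : Integrable (fun x => (f x : ℂ) * character k x) torusMeasure :=
  hf.ofReal.mul_bdd (c := 1) (continuous_character k).aestronglyMeasurable
    (.of_forall fun x => (norm_character k x).le)

theorem re_fourierCoefficient {f : Torus → ℝ} (hf : Integrable f torusMeasure) (k : Fin 2 → ℤ) :
    (fourierCoefficient f k).re = ∫ x, f x * (character (-k) x).re ∂torusMeasure := by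
  rw [fourierCoefficient_eq]
  refine (integral_re (integrable_mul_character hf (-k))).symm.trans ?_
  simp

theorem im_fourierCoefficient {f : Torus → ℝ} (hf : Integrable f torusMeasure) (k : Fin 2 → ℤ) :
    (fourierCoefficient f k).im = ∫ x, f x * (character (-k) x).im ∂torusMeasure := by
  rw [fourierCoefficient_eq]
  refine (integral_im (integrable_mul_character hf (-k))).symm.trans ?_
  simp

variable {f ψ : Torus → ℝ}

theorem frequency_neg (k : Fin 2 → ℤ) : frequency (-k) = -frequency k := by
  ext i; simp [frequency]

theorem IsPoissonSolution.integrable (h : IsPoissonSolution f ψ) : Integrable ψ torusMeasure :=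
  h.continuous.integrable_of_hasCompactSupport (HasCompactSupport.of_compactSpace ψ)

/-- The Poisson equation in Fourier variables, by testing against `cos(k·x)` and `sin(k·x)`. -/
theorem IsPoissonSolution.fourierCoefficient_mul (h : IsPoissonSolution f ψ)
    (hf : Integrable f torusMeasure) (k : Fin 2 → ℤ) :
    ((‖frequency k‖ ^ 2 : ℝ) : ℂ) * fourierCoefficient ψ k = -fourierCoefficient f k := by
  have hin : ContDiff ℝ ∞ (fun v : Plane => ⟪frequency (-k), v⟫_ℝ) :=
    (innerSL ℝ (frequency (-k))).contDiff
  have hre := h.weak_eq (fun y => (character (-k) y).re) (by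
    simp only [character_proj, Complex.exp_ofReal_mul_I_re]
    exact Real.contDiff_cos.comp hin)
  have him := h.weak_eq (fun y => (character (-k) y).im) (by
    simp only [character_proj, Complex.exp_ofReal_mul_I_im]
    exact Real.contDiff_sin.comp hin)
  simp only [torusLaplacian_re_character, torusLaplacian_im_character, frequency_neg, norm_neg,
    mul_left_comm (ψ _), integral_const_mul] at hre him
  apply Complex.ext
  · rw [Complex.re_ofReal_mul, Complex.neg_re, re_fourierCoefficient h.integrable,
      re_fourierCoefficient hf, ← hre]
    ring
  · rw [Complex.im_ofReal_mul, Complex.neg_im, im_fourierCoefficient h.integrable,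
      im_fourierCoefficient hf, ← him]
    ring

theorem IsPoissonSolution.fourierCoefficient_zero (h : IsPoissonSolution f ψ) :
    fourierCoefficient ψ 0 = 0 := by
  have : ∀ x, character (-0) x = 1 := fun x => by simp [character]
  simp only [fourierCoefficient_eq, this, mul_one]
  rw [integral_complex_ofReal, h.average_zero, Complex.ofReal_zero]

theorem IsPoissonSolution.norm_sq_mul_norm (h : IsPoissonSolution f ψ)
    (hf : Integrable f torusMeasure) (k : Fin 2 → ℤ) :
    ‖frequency k‖ ^ 2 * ‖fourierCoefficient ψ k‖ = ‖fourierCoefficient f k‖ := by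
  have := congrArg norm (h.fourierCoefficient_mul hf k)
  simpa using this

/-! ### Sobolev regularity -/

theorem summable_inv_one_add_sq : Summable fun k : ℤ => (1 + (k : ℝ) ^ 2)⁻¹ := by
  refine (Real.summable_one_div_int_pow.2 one_lt_two).of_norm_bounded_eventually ?_
  filter_upwards [(Set.finite_singleton (0 : ℤ)).compl_mem_cofinite] with k hk
  have hk' : (0 : ℝ) < (k : ℝ) ^ 2 := by
    have : (k : ℝ) ≠ 0 := by exact_mod_cast hk
    positivity
  rw [norm_inv, Real.norm_of_nonneg (by positivity), one_div]
  gcongr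
  linarith

theorem summable_inv_sq_weight :
    Summable fun k : Fin 2 → ℤ => ((1 + ((k 0 : ℝ) ^ 2 + (k 1 : ℝ) ^ 2)) ^ 2)⁻¹ := by
  have h := summable_inv_one_add_sq.mul_of_nonneg summable_inv_one_add_sq
    (fun k => by positivity) (fun k => by positivity)
  refine .of_nonneg_of_le (fun k => by positivity) (fun k => ?_)
    (((finTwoArrowEquiv ℤ).summable_iff).2 h)
  change _ ≤ (1 + (k 0 : ℝ) ^ 2)⁻¹ * (1 + (k 1 : ℝ) ^ 2)⁻¹
  rw [← mul_inv]
  gcongr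
  nlinarith [sq_nonneg (k 0 : ℝ), sq_nonneg (k 1 : ℝ),
    mul_nonneg (sq_nonneg (k 0 : ℝ)) (sq_nonneg (k 1 : ℝ))]

theorem sobolevTerm_eq (s : ℕ) (f : Torus → ℝ) (k : Fin 2 → ℤ) :
    sobolevTerm s f k = ‖fourierCoefficient f k‖ ^ 2 * (1 + ‖frequency k‖ ^ 2) ^ s := by
  rw [sobolevTerm, norm_sq_frequency]

theorem MemSobolev.mono {s r : ℕ} (hrs : r ≤ s) (h : MemSobolev s f) : MemSobolev r f := by
  refine ⟨h.1, .of_nonneg_of_le (fun k => ?_) (fun k => ?_) h.2⟩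
  · unfold sobolevTerm; positivity
  · simp only [sobolevTerm_eq]
    gcongr
    · nlinarith [sq_nonneg ‖frequency k‖]

/-- The Cauchy–Schwarz inequality bounds the absolute sum of the Fourier coefficients (the norm in
the Wiener algebra) by the `H²` norm. -/
theorem MemSobolev.tsum_norm_fourierCoefficient_le (h : MemSobolev 2 f) :
    ∑' k, ‖fourierCoefficient f k‖ ≤ sobolevNorm 2 f *
        √(∑' k : Fin 2 → ℤ, ((1 + ((k 0 : ℝ) ^ 2 + (k 1 : ℝ) ^ 2)) ^ 2)⁻¹) := by
  have hw (k : Fin 2 → ℤ) : 0 < 1 + ((k 0 : ℝ) ^ 2 + (k 1 : ℝ) ^ 2) := by positivity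
  have e1 (k : Fin 2 → ℤ) :
      (‖fourierCoefficient f k‖ * (1 + ((k 0 : ℝ) ^ 2 + (k 1 : ℝ) ^ 2))) ^ (2 : ℝ) =
        sobolevTerm 2 f k := by
    rw [Real.rpow_two, mul_pow, sobolevTerm]
  have e2 (k : Fin 2 → ℤ) : ((1 + ((k 0 : ℝ) ^ 2 + (k 1 : ℝ) ^ 2))⁻¹) ^ (2 : ℝ) =
      ((1 + ((k 0 : ℝ) ^ 2 + (k 1 : ℝ) ^ 2)) ^ 2)⁻¹ := by
    rw [Real.rpow_two, inv_pow]
  have := Real.inner_le_Lp_mul_Lq_tsum_of_nonneg (p := 2) (q := 2) .two_two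
    (f := fun k : Fin 2 → ℤ => ‖fourierCoefficient f k‖ * (1 + ((k 0 : ℝ) ^ 2 + (k 1 : ℝ) ^ 2)))
    (g := fun k : Fin 2 → ℤ => (1 + ((k 0 : ℝ) ^ 2 + (k 1 : ℝ) ^ 2))⁻¹)
    (fun k => mul_nonneg (norm_nonneg _) (hw k).le) (fun k => (inv_pos.2 (hw k)).le)
    (by simpa only [e1] using h.2) (by simpa only [e2] using summable_inv_sq_weight)
  simp only [e1, e2, mul_assoc, mul_inv_cancel₀ (hw _).ne', mul_one, ← Real.sqrt_eq_rpow] at this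
  exact this

/-- Two Sobolev indices suffice to make the differentiated Fourier series absolutely convergent. -/
theorem MemSobolev.summable_pow_mul_norm {s : ℕ} (h : MemSobolev (s + 2) f) :
    Summable fun k => ‖frequency k‖ ^ s * ‖fourierCoefficient f k‖ := by
  refine .of_nonneg_of_le (fun k => by positivity) (fun k => ?_)
    ((h.2.add summable_inv_sq_weight).div_const 2)
  rw [sobolevTerm_eq, ← norm_sq_frequency]
  set a := ‖fourierCoefficient f k‖
  set w := 1 + ‖frequency k‖ ^ 2 with hw
  have hw0 : 0 < w := by positivity
  have h1 : (‖frequency k‖ ^ s) ^ 2 ≤ w ^ s := by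
    rw [← pow_mul, mul_comm, pow_mul]
    gcongr
    linarith
  have h2 : (‖frequency k‖ ^ s * a) ^ 2 ≤ (a ^ 2 * w ^ (s + 2)) * (w ^ 2)⁻¹ := by
    rw [mul_pow, pow_add]
    field_simp
    exact mul_le_mul_of_nonneg_left h1 (by positivity) |>.trans_eq' (by ring)
  have h3 : 0 ≤ (w ^ 2)⁻¹ := by positivity
  have h4 : 0 ≤ a ^ 2 * w ^ (s + 2) := by positivity
  -- `a b ≤ ((a + b) / 2)²` for the Sobolev term `a` and the summable weight `b`
  refine abs_le_of_sq_le_sq' ?_ (by positivity) |>.2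
  nlinarith [sq_nonneg (a ^ 2 * w ^ (s + 2) - (w ^ 2)⁻¹)]

/-! ### Regularity of the stream function -/

theorem norm_iteratedFDeriv_exp_ofReal_mul_I_le (n : ℕ) (x : ℝ) :
    ‖iteratedFDeriv ℝ n (fun s : ℝ => Complex.exp (s * Complex.I)) x‖ ≤ 1 := by
  have h (n : ℕ) : iteratedDeriv n (fun s : ℝ => Complex.exp (s * Complex.I)) =
      fun s : ℝ => Complex.I ^ n * Complex.exp (s * Complex.I) := by
    induction n with
    | zero => simp
    | succ n ih =>
      rw [iteratedDeriv_succ, ih]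
      ext s
      have h1 : HasDerivAt (fun s : ℝ => (s : ℂ) * Complex.I) Complex.I s := by
        simpa using (Complex.ofRealCLM.hasDerivAt (x := s)).mul_const Complex.I
      rw [(h1.cexp.const_mul _).deriv]
      ring
  rw [norm_iteratedFDeriv_eq_norm_iteratedDeriv, h]
  simp [Complex.norm_exp_ofReal_mul_I]

/-- The term of frequency `k` of the Fourier series of `f`, as a function on the plane. -/
def planeFourierTerm (f : Torus → ℝ) (k : Fin 2 → ℤ) (v : Plane) : ℝ :=
  (fourierCoefficient f k * character k (proj v)).re

theorem planeFourierTerm_eq (f : Torus → ℝ) (k : Fin 2 → ℤ) : planeFourierTerm f k =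
    (Complex.reCLM.comp (ContinuousLinearMap.mul ℝ ℂ (fourierCoefficient f k))) ∘
      (fun s : ℝ => Complex.exp (s * Complex.I)) ∘ (innerSL ℝ (frequency k)) := by
  ext v
  simp [planeFourierTerm, character_proj]

theorem contDiff_exp_ofReal_mul_I {n : WithTop ℕ∞} :
    ContDiff ℝ n (fun s : ℝ => Complex.exp (s * Complex.I)) :=
  (Complex.ofRealCLM.contDiff.mul contDiff_const).cexp

theorem contDiff_planeFourierTerm (f : Torus → ℝ) (k : Fin 2 → ℤ) {n : WithTop ℕ∞} :
    ContDiff ℝ n (planeFourierTerm f k) := by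
  rw [planeFourierTerm_eq]
  exact (ContinuousLinearMap.contDiff _).comp
    (contDiff_exp_ofReal_mul_I.comp (ContinuousLinearMap.contDiff _))

theorem norm_iteratedFDeriv_planeFourierTerm_le (f : Torus → ℝ) (k : Fin 2 → ℤ) (n : ℕ)
    (v : Plane) : ‖iteratedFDeriv ℝ n (planeFourierTerm f k) v‖ ≤
      ‖frequency k‖ ^ n * ‖fourierCoefficient f k‖ := by
  rw [planeFourierTerm_eq, ContinuousLinearMap.iteratedFDeriv_comp_left (n := n) _
    (contDiff_exp_ofReal_mul_I.comp (ContinuousLinearMap.contDiff _)).contDiffAt le_rfl]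
  refine (ContinuousLinearMap.norm_compContinuousMultilinearMap_le _ _).trans ?_
  rw [ContinuousLinearMap.iteratedFDeriv_comp_right (i := n) _
    (contDiff_exp_ofReal_mul_I (n := n)) _ le_rfl]
  have h1 := ContinuousMultilinearMap.norm_compContinuousLinearMap_le
    (iteratedFDeriv ℝ n (fun s : ℝ => Complex.exp (s * Complex.I)) (innerSL ℝ (frequency k) v))
    (fun _ => innerSL ℝ (frequency k))
  have h2 : ‖Complex.reCLM.comp (ContinuousLinearMap.mul ℝ ℂ (fourierCoefficient f k))‖ ≤
      ‖fourierCoefficient f k‖ := by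
    refine (ContinuousLinearMap.opNorm_comp_le _ _).trans ?_
    rw [Complex.reCLM_norm, one_mul]
    exact ContinuousLinearMap.opNorm_mul_apply_le _ _ _
  have h3 := norm_iteratedFDeriv_exp_ofReal_mul_I_le n (innerSL ℝ (frequency k) v)
  rw [Finset.prod_const, Finset.card_univ, Fintype.card_fin, innerSL_apply_norm] at h1
  calc _ ≤ ‖fourierCoefficient f k‖ * (1 * ‖frequency k‖ ^ n) := by
        gcongr
        exact h1.trans (by gcongr)
    _ = _ := by ring

/-- For functions of average zero, lower powers of the frequency are dominated by higher ones,
since nonzero frequencies have norm at least one. -/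
theorem summable_pow_mul_norm_of_le {a b : ℕ} (hab : a ≤ b)
    (h0 : fourierCoefficient ψ 0 = 0)
    (h : Summable fun k => ‖frequency k‖ ^ b * ‖fourierCoefficient ψ k‖) :
    Summable fun k => ‖frequency k‖ ^ a * ‖fourierCoefficient ψ k‖ := by
  refine .of_nonneg_of_le (fun k => by positivity) (fun k => ?_) h
  rcases eq_or_ne k 0 with rfl | hk
  · simp [h0]
  · gcongr
    exact one_le_norm_frequency hk

theorem IsPoissonSolution.summable_pow_mul_norm (h : IsPoissonSolution f ψ) {s : ℕ} (hs : 2 ≤ s)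
    (hf : MemSobolev s f) : Summable fun k => ‖frequency k‖ ^ s * ‖fourierCoefficient ψ k‖ := by
  obtain ⟨s, rfl⟩ := Nat.exists_eq_add_of_le' hs
  simpa only [pow_add, mul_assoc, h.norm_sq_mul_norm (hf.1.integrable (by norm_num))] using
    hf.summable_pow_mul_norm

theorem IsPoissonSolution.comp_proj_eq (h : IsPoissonSolution f ψ) {s : ℕ} (hs : 2 ≤ s)
    (hf : MemSobolev s f) :
    (fun v : Plane => ψ (proj v)) = fun v => ∑' k, planeFourierTerm ψ k v := by
  ext v
  have := summable_pow_mul_norm_of_le (Nat.zero_le s) h.fourierCoefficient_zero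
    (h.summable_pow_mul_norm hs hf)
  exact (hasSum_fourierCoefficient h.continuous (by simpa using this) (proj v)).tsum_eq.symm

/-- The stream function gains two derivatives over `f` in Sobolev spaces, and two are lost in the
embedding into `Cˢ`. -/
theorem IsPoissonSolution.contDiff (h : IsPoissonSolution f ψ) {s : ℕ} (hs : 2 ≤ s)
    (hf : MemSobolev s f) : ContDiff ℝ s (fun v : Plane => ψ (proj v)) := by
  rw [h.comp_proj_eq hs hf]
  refine contDiff_tsum (N := (s : ℕ∞))
    (v := fun n k => ‖frequency k‖ ^ n * ‖fourierCoefficient ψ k‖)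
    (fun k => contDiff_planeFourierTerm ψ k) (fun n hn => ?_)
    (fun n k v _ => norm_iteratedFDeriv_planeFourierTerm_le ψ k n v)
  exact summable_pow_mul_norm_of_le (by exact_mod_cast hn) h.fourierCoefficient_zero
    (h.summable_pow_mul_norm hs hf)

theorem IsPoissonSolution.norm_iteratedFDeriv_two_le (h : IsPoissonSolution f ψ)
    (hf : MemSobolev 2 f) (v : Plane) :
    ‖iteratedFDeriv ℝ 2 (fun v : Plane => ψ (proj v)) v‖ ≤ ∑' k, ‖fourierCoefficient f k‖ := by
  have hsum := h.summable_pow_mul_norm le_rfl hf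
  rw [h.comp_proj_eq le_rfl hf, iteratedFDeriv_tsum_apply (N := ((2 : ℕ) : ℕ∞))
    (v := fun n k => ‖frequency k‖ ^ n * ‖fourierCoefficient ψ k‖)
    (fun k => contDiff_planeFourierTerm ψ k) (fun n hn => summable_pow_mul_norm_of_le
      (by exact_mod_cast hn) h.fourierCoefficient_zero hsum)
    (fun n k v _ => norm_iteratedFDeriv_planeFourierTerm_le ψ k n v) (by norm_cast)]
  refine (tsum_of_norm_bounded hsum.hasSum
    fun k => norm_iteratedFDeriv_planeFourierTerm_le ψ k 2 v).trans_eq ?_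
  simp only [h.norm_sq_mul_norm (hf.1.integrable (by norm_num))]

/-! ### The Hamiltonian vector field -/

/-- The map `ℓ ↦ J ℓ^♯` which turns a differential into a Hamiltonian vector. -/
def symplecticSharp : (Plane →L[ℝ] ℝ) →L[ℝ] Plane :=
  LinearMap.toContinuousLinearMap
    { toFun := fun ℓ => Matrix.toEuclideanLin J ((InnerProductSpace.toDual ℝ Plane).symm ℓ)
      map_add' := by simp
      map_smul' := by simp }

theorem toDual_symm_apply_coord (ℓ : Plane →L[ℝ] ℝ) (i : Fin 2) :
    (InnerProductSpace.toDual ℝ Plane).symm ℓ i = ℓ (EuclideanSpace.single i 1) := by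
  rw [← InnerProductSpace.toDual_symm_apply (𝕜 := ℝ) (x := EuclideanSpace.single i 1) (y := ℓ)]
  exact (by simp [EuclideanSpace.inner_single_right] : ∀ v : Plane,
    v i = ⟪v, EuclideanSpace.single i 1⟫_ℝ) _

theorem symplecticSharp_apply_zero (ℓ : Plane →L[ℝ] ℝ) :
    symplecticSharp ℓ 0 = ℓ (EuclideanSpace.single 1 1) := by
  rw [← toDual_symm_apply_coord]
  simp [symplecticSharp, J, Matrix.toLpLin_apply, dotProduct, Fin.sum_univ_two]

theorem symplecticSharp_apply_one (ℓ : Plane →L[ℝ] ℝ) :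
    symplecticSharp ℓ 1 = -ℓ (EuclideanSpace.single 0 1) := by
  rw [← toDual_symm_apply_coord]
  simp [symplecticSharp, J, Matrix.toLpLin_apply, dotProduct, Fin.sum_univ_two]

theorem norm_symplecticSharp_apply (ℓ : Plane →L[ℝ] ℝ) : ‖symplecticSharp ℓ‖ = ‖ℓ‖ := by
  rw [← (InnerProductSpace.toDual ℝ Plane).symm.norm_map ℓ,
    ← sq_eq_sq₀ (norm_nonneg _) (norm_nonneg _), EuclideanSpace.norm_sq_eq,
    EuclideanSpace.norm_sq_eq]
  simp only [Fin.sum_univ_two, symplecticSharp_apply_zero, symplecticSharp_apply_one,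
    toDual_symm_apply_coord, norm_neg]
  ring

theorem hamiltonianField_eq (ψ : Torus → ℝ) :
    hamiltonianField ψ = fun x => symplecticSharp (fderiv ℝ (fun v : Plane => ψ (proj v)) x) :=
  rfl

theorem hamiltonianField_add_period {p : Plane} (hp : proj p = 0) (x : Plane) :
    hamiltonianField ψ (x + p) = hamiltonianField ψ x := by
  simp only [hamiltonianField_eq]
  rw [← fderiv_comp_add_right]
  simp only [proj_add, hp, add_zero]

theorem contDiff_hamiltonianField {n : ℕ}
    (hψ : ContDiff ℝ (n + 1 : ℕ) (fun v : Plane => ψ (proj v))) :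
    ContDiff ℝ n (hamiltonianField ψ) := by
  rw [hamiltonianField_eq]
  exact symplecticSharp.contDiff.comp (hψ.fderiv_right (by norm_cast))

theorem fderiv_hamiltonianField_apply (hψ : ContDiff ℝ 2 (fun v : Plane => ψ (proj v)))
    (x v : Plane) : fderiv ℝ (hamiltonianField ψ) x v =
      symplecticSharp (fderiv ℝ (fderiv ℝ fun v : Plane => ψ (proj v)) x v) := by
  have h := ((hψ.fderiv_right (m := 1) (by norm_num)).differentiable (by norm_num)
    |>.differentiableAt (x := x)).hasFDerivAt
  have h2 : HasFDerivAt (hamiltonianField ψ) _ x := symplecticSharp.hasFDerivAt.comp x h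
  rw [h2.fderiv]
  rfl

theorem norm_fderiv_hamiltonianField_le (hψ : ContDiff ℝ 2 (fun v : Plane => ψ (proj v)))
    (x : Plane) : ‖fderiv ℝ (hamiltonianField ψ) x‖ ≤
      ‖iteratedFDeriv ℝ 2 (fun v : Plane => ψ (proj v)) x‖ := by
  refine ContinuousLinearMap.opNorm_le_bound _ (norm_nonneg _) fun v => ?_
  rw [fderiv_hamiltonianField_apply hψ, norm_symplecticSharp_apply,
    ← norm_iteratedFDeriv_fderiv, ← norm_iteratedFDeriv_fderiv, norm_iteratedFDeriv_zero]
  exact ContinuousLinearMap.le_opNorm _ v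

/-- Hamiltonian vector fields are divergence free. -/
theorem trace_jacobian_hamiltonianField (hψ : ContDiff ℝ 2 (fun v : Plane => ψ (proj v)))
    (x : Plane) : (jacobian (hamiltonianField ψ) x).trace = 0 := by
  have hsymm : IsSymmSndFDerivAt ℝ (fun v : Plane => ψ (proj v)) x :=
    hψ.contDiffAt.isSymmSndFDerivAt (by simp)
  simp only [Matrix.trace_fin_two, jacobian, Matrix.of_apply, fderiv_hamiltonianField_apply hψ,
    symplecticSharp_apply_zero, symplecticSharp_apply_one]
  rw [hsymm.eq]
  ring

/-! ### Symplectic maps and diffeomorphisms of the torus -/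

theorem jacobian_eq_toMatrix (F : Plane → Plane) (x : Plane) :
    jacobian F x = LinearMap.toMatrix (EuclideanSpace.basisFun (Fin 2) ℝ).toBasis
      (EuclideanSpace.basisFun (Fin 2) ℝ).toBasis (fderiv ℝ F x).toLinearMap := by
  ext i j
  simp [jacobian, LinearMap.toMatrix_apply]

theorem jacobian_comp {F G : Plane → Plane} {x : Plane} (hF : DifferentiableAt ℝ F (G x))
    (hG : DifferentiableAt ℝ G x) :
    jacobian (F ∘ G) x = jacobian F (G x) * jacobian G x := by
  simp only [jacobian_eq_toMatrix]
  rw [fderiv_comp x hF hG, ← LinearMap.toMatrix_comp]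
  rfl

/-- In the plane, `Aᵀ J A = det(A) J`. -/
theorem isSymplectic_of_det_eq_one {F : Plane → Plane} (h : ∀ x, (jacobian F x).det = 1) :
    IsSymplectic F := by
  intro x
  have hx := h x
  rw [Matrix.det_fin_two] at hx
  ext i j
  fin_cases i <;> fin_cases j <;>
    simp [J, Matrix.mul_apply, Fin.sum_univ_two] <;> linarith

theorem jacobian_halfStep {X : Plane → Plane} (hX : Differentiable ℝ X) (t : ℝ) (x : Plane) :
    jacobian (halfStep X t) x = 1 + (t / 2) • jacobian X x := by
  ext i j
  simp only [jacobian, Matrix.of_apply, (hasFDerivAt_halfStep hX t x).fderiv]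
  simp [Matrix.one_apply]

/-- For a divergence free field, the steps `t` and `-t` have the same Jacobian determinant. -/
theorem det_jacobian_halfStep {X : Plane → Plane} (hX : Differentiable ℝ X) {x : Plane}
    (htr : (jacobian X x).trace = 0) (t : ℝ) :
    (jacobian (halfStep X t) x).det = 1 + (t / 2) ^ 2 * (jacobian X x).det := by
  rw [Matrix.trace_fin_two] at htr
  rw [jacobian_halfStep hX, Matrix.det_fin_two, Matrix.det_fin_two]
  simp
  linear_combination (t / 2) * htr

/-- With `M` the midpoint map, `ℰ₋ₜ ∘ M = id` and `Φₜ = ℰₜ ∘ M`, where `Dℰₜ` and `Dℰ₋ₜ` have the same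
determinant at the midpoint. -/
theorem isSymplectic_midpointFlow {X : Plane → Plane} {K : NNReal} (hX : LipschitzWith K X)
    (hX1 : ContDiff ℝ 1 X) (htr : ∀ x, (jacobian X x).trace = 0) {t : ℝ}
    (ht : t ∈ admissibleTimes K) : IsSymplectic (midpointFlow X t) := by
  refine isSymplectic_of_det_eq_one fun x => ?_
  have hXd : Differentiable ℝ X := hX1.differentiable (by norm_num)
  have hm : DifferentiableAt ℝ (stepMidpoint X t) x :=
    ((contDiffAt_stepMidpoint (n := 1) one_ne_zero hX (by exact_mod_cast hX1) ht x).comp x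
      (contDiffAt_const.prodMk contDiffAt_id)).differentiableAt (by norm_num)
  have hE (r : ℝ) (y : Plane) : DifferentiableAt ℝ (halfStep X r) y :=
    (hasFDerivAt_halfStep hXd r y).differentiableAt
  have h1 : jacobian (midpointFlow X t) x = _ := jacobian_comp (hE t _) hm
  have h2 : jacobian (halfStep X (-t) ∘ stepMidpoint X t) x = _ := jacobian_comp (hE (-t) _) hm
  have h3 : halfStep X (-t) ∘ stepMidpoint X t = id :=
    funext (halfStep_neg_stepMidpoint hX ht)
  have h4 : jacobian (id : Plane → Plane) x = 1 := by
    rw [jacobian_eq_toMatrix, fderiv_id]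
    exact LinearMap.toMatrix_id _
  rw [h3, h4] at h2
  have h5 := congrArg Matrix.det h2
  rw [Matrix.det_one, Matrix.det_mul, det_jacobian_halfStep hXd (htr _)] at h5
  rw [h1, Matrix.det_mul, det_jacobian_halfStep hXd (htr _)]
  linear_combination -h5

/-- Mutually inverse `Cⁿ` maps of the plane that commute with the periods descend to the torus. -/
theorem isTorusDiffeo_of_inverse {n : ℕ} {F G : Plane → Plane} (hF : ContDiff ℝ n F)
    (hG : ContDiff ℝ n G) (hGF : Function.LeftInverse G F) (hFG : Function.RightInverse G F)
    (hFp : ∀ p, proj p = 0 → ∀ x, F (x + p) = F x + p) : IsTorusDiffeo n F := by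
  have hGp (p : Plane) (hp : proj p = 0) (x : Plane) : G (x + p) = G x + p := by
    rw [← hGF (G x + p), hFp p hp, hFG x]
  have descend {H : Plane → Plane} (hH : ∀ p, proj p = 0 → ∀ x, H (x + p) = H x + p) (x : Plane) :
      proj (H (Function.surjInv proj_surjective (proj x))) = proj (H x) := by
    set y := Function.surjInv proj_surjective (proj x)
    have hy : proj y = proj x := Function.surjInv_eq proj_surjective (proj x)
    have h0 : proj (y - x) = 0 := by rw [proj_sub, hy, sub_self]
    have := hH (y - x) h0 x
    rw [add_sub_cancel] at this
    rw [this, proj_add, h0, add_zero]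
  refine ⟨⟨fun z => proj (F (Function.surjInv proj_surjective z)),
    fun z => proj (G (Function.surjInv proj_surjective z)), fun z => ?_, fun z => ?_⟩, hF,
    fun x => (descend hFp x).symm, G, hG, fun x => (descend hGp x).symm⟩
  · change proj (G (Function.surjInv proj_surjective (proj (F _)))) = z
    rw [descend hGp, hGF, Function.surjInv_eq proj_surjective]
  · change proj (F (Function.surjInv proj_surjective (proj (G _)))) = z
    rw [descend hFp, hFG, Function.surjInv_eq proj_surjective]

/-! ### The implicit midpoint step on the torus -/

variable {X : Plane → Plane} {K : NNReal} {n : ℕ}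

theorem isTorusDiffeo_stepMidpoint (hX : LipschitzWith K X) (hn : n ≠ 0) (hXn : ContDiff ℝ n X)
    (hXp : ∀ p, proj p = 0 → ∀ x, X (x + p) = X x) {t : ℝ} (ht : t ∈ admissibleTimes K) :
    IsTorusDiffeo n (halfStep X (-t)) ∧ IsTorusDiffeo n (stepMidpoint X t) := by
  have hE : ContDiff ℝ n (halfStep X (-t)) :=
    (contDiff_halfStep hXn).comp (contDiff_const.prodMk contDiff_id)
  have hM : ContDiff ℝ n (stepMidpoint X t) := contDiff_iff_contDiffAt.2 fun x =>
    (contDiffAt_stepMidpoint hn hX hXn ht x).comp x (contDiffAt_const.prodMk contDiffAt_id)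
  exact ⟨isTorusDiffeo_of_inverse hE hM (stepMidpoint_halfStep_neg hX ht)
      (halfStep_neg_stepMidpoint hX ht) fun p hp => halfStep_add_period (hXp p hp) _,
    isTorusDiffeo_of_inverse hM hE (halfStep_neg_stepMidpoint hX ht)
      (stepMidpoint_halfStep_neg hX ht) fun p hp => stepMidpoint_add_period hX ht (hXp p hp)⟩

theorem isTorusDiffeo_midpointFlow (hX : LipschitzWith K X) (hn : n ≠ 0) (hXn : ContDiff ℝ n X)
    (hXp : ∀ p, proj p = 0 → ∀ x, X (x + p) = X x) {t : ℝ} (ht : t ∈ admissibleTimes K) :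
    IsTorusDiffeo n (midpointFlow X t) := by
  have hΦ {r : ℝ} (hr : r ∈ admissibleTimes K) : ContDiff ℝ n (midpointFlow X r) :=
    contDiff_iff_contDiffAt.2 fun x =>
      (contDiffAt_midpointFlow hn hX hXn hr x).comp x (contDiffAt_const.prodMk contDiffAt_id)
  have ht' := neg_mem_admissibleTimes ht
  refine isTorusDiffeo_of_inverse (hΦ ht) (hΦ ht') (midpointFlow_neg_midpointFlow hX ht)
    (fun x => ?_) fun p hp => midpointFlow_add_period hX ht (hXp p hp)
  simpa using midpointFlow_neg_midpointFlow hX ht' x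

/-- The Lipschitz constant of `J∇ψ` is at most `∑ |ω̂ₖ|` for `ω = Δψ`. -/
theorem IsPoissonSolution.lipschitzWith_hamiltonianField (h : IsPoissonSolution f ψ)
    (hf : MemSobolev 2 f) {K : NNReal} (hK : ∑' k, ‖fourierCoefficient f k‖ ≤ K) :
    LipschitzWith K (hamiltonianField ψ) := by
  have hψ : ContDiff ℝ 2 (fun v : Plane => ψ (proj v)) := h.contDiff le_rfl hf
  refine lipschitzWith_of_nnnorm_fderiv_le (𝕜 := ℝ) ?_ fun x => ?_
  · exact (contDiff_hamiltonianField (n := 1) hψ).differentiable (by norm_num)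
  · rw [← NNReal.coe_le_coe]
    exact (norm_fderiv_hamiltonianField_le hψ x).trans
      ((h.norm_iteratedFDeriv_two_le hf x).trans hK)

/-- The remainder of the modified field on the torus, read off at an arbitrary lift. -/
def torusRemainder (X : Plane → Plane) (t : ℝ) (z : Torus) : Plane :=
  modifiedFieldRemainder X t (Function.surjInv proj_surjective z)

theorem torusRemainder_proj (hX : LipschitzWith K X) (hX1 : ContDiff ℝ 1 X)
    (hXp : ∀ p, proj p = 0 → ∀ x, X (x + p) = X x) {t : ℝ} (ht : t ∈ admissibleTimes K)
    (x : Plane) : torusRemainder X t (proj x) = modifiedFieldRemainder X t x := by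
  unfold torusRemainder
  set y := Function.surjInv proj_surjective (proj x)
  have hy : proj (y - x) = 0 := by
    rw [proj_sub, Function.surjInv_eq proj_surjective, sub_self]
  have := modifiedFieldRemainder_add_period hX hX1 (hXp _ hy) ht x
  rwa [add_sub_cancel] at this

end MidpointTorus
end

theorem proposition4p1 :
    ∃ R₀ : ℝ, 0 < R₀ ∧
      ∀ (s : ℕ) (ω₀ ψ : MidpointTorus.Torus → ℝ) (τ : ℝ),
        3 ≤ s →
        MidpointTorus.MemSobolev s ω₀ →
        ∫ x, ω₀ x ∂MidpointTorus.torusMeasure = 0 →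
        MidpointTorus.IsPoissonSolution ω₀ ψ →
        0 < τ → τ < 1 →
        τ * MidpointTorus.sobolevNorm 2 ω₀ * R₀ < 1 →
        ∃ Φ : ℝ → MidpointTorus.Plane → MidpointTorus.Plane,
          -- i) `Φ t x` is the unique solution of the implicit midpoint equation
          (∀ t ∈ Icc (-τ) τ, ∀ x y,
            MidpointTorus.IsMidpointStep ψ t x y ↔ y = Φ t x) ∧
          -- ii) regularity, symplectic diffeomorphism, inverse
          ContDiffOn ℝ (s - 1 : ℕ) (fun p : ℝ × MidpointTorus.Plane => Φ p.1 p.2)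
            (Icc (-τ) τ ×ˢ univ) ∧
          (∀ t ∈ Icc (-τ) τ,
            MidpointTorus.IsTorusDiffeo (s - 1) (Φ t) ∧
            MidpointTorus.IsSymplectic (Φ t) ∧
            Function.LeftInverse (Φ (-t)) (Φ t) ∧
            Function.RightInverse (Φ (-t)) (Φ t)) ∧
          -- iii) factorization through the explicit and implicit Euler half steps
          (∀ t ∈ Icc (-τ) τ,
            MidpointTorus.IsTorusDiffeo (s - 1) (MidpointTorus.eulerMap ψ t) ∧
            ∃ Estar : MidpointTorus.Plane → MidpointTorus.Plane,
              Function.LeftInverse Estar (MidpointTorus.eulerMap ψ (-t)) ∧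
              Function.RightInverse Estar (MidpointTorus.eulerMap ψ (-t)) ∧
              MidpointTorus.IsTorusDiffeo (s - 1) Estar ∧
              Φ t = MidpointTorus.eulerMap ψ t ∘ Estar) ∧
          -- iv) `V(t,x) = ∂ₜ(Φ₋ₜ) ∘ Φₜ(x)` exists and equals `-J∇ψ(x) + t² R(t,x)`
          (4 ≤ s →
            ∃ R : ℝ → MidpointTorus.Torus → MidpointTorus.Plane,
              ContDiffOn ℝ (s - 4 : ℕ)
                (fun p : ℝ × MidpointTorus.Plane => R p.1 (MidpointTorus.proj p.2))
                (Icc (-τ) τ ×ˢ univ) ∧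
              ∀ t ∈ Icc (-τ) τ, ∀ x : MidpointTorus.Plane,
                HasDerivWithinAt (fun r => Φ (-r) (Φ t x))
                  (-MidpointTorus.hamiltonianField ψ x + t ^ 2 • R t (MidpointTorus.proj x))
                  (Icc (-τ) τ) t) := by
  open MidpointTorus in
  set C : ℝ := √(∑' k : Fin 2 → ℤ, ((1 + ((k 0 : ℝ) ^ 2 + (k 1 : ℝ) ^ 2)) ^ 2)⁻¹) with hC
  refine ⟨C + 1, by positivity, fun s ω₀ ψ τ hs hω _ hψ hτ _ hsmall => ?_⟩
  have hω2 : MemSobolev 2 ω₀ := hω.mono (by omega)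
  have hnorm : 0 ≤ sobolevNorm 2 ω₀ := Real.sqrt_nonneg _
  let K : NNReal := ⟨sobolevNorm 2 ω₀ * C, by positivity⟩
  set X : Plane → Plane := hamiltonianField ψ with hXdef
  have hX : LipschitzWith K X :=
    hψ.lipschitzWith_hamiltonianField hω2 hω2.tsum_norm_fourierCoefficient_le
  have hψs : ContDiff ℝ s (fun v : Plane => ψ (proj v)) := hψ.contDiff (by omega) hω
  have hψ2 : ContDiff ℝ 2 (fun v : Plane => ψ (proj v)) :=
    hψs.of_le (by exact_mod_cast (by omega : 2 ≤ s))
  have hXs : ContDiff ℝ (s - 1 : ℕ) X :=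
    contDiff_hamiltonianField (by rwa [Nat.sub_add_cancel (by omega)])
  have hX2 : ContDiff ℝ 2 X := hXs.of_le (by exact_mod_cast (by omega : 2 ≤ s - 1))
  have hX1 : ContDiff ℝ 1 X := hX2.of_le (by norm_num)
  have hs1 : s - 1 ≠ 0 := by omega
  have hXp : ∀ p, proj p = 0 → ∀ x, X (x + p) = X x := fun p hp x =>
    hamiltonianField_add_period hp x
  have hadm : ∀ t ∈ Icc (-τ) τ, t ∈ admissibleTimes K := by
    intro t ht
    have ht' : |t| ≤ τ := abs_le.2 ht
    calc |t| * (sobolevNorm 2 ω₀ * C) ≤ τ * (sobolevNorm 2 ω₀ * (C + 1)) := by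
          gcongr
          linarith
      _ < 1 := by rwa [← mul_assoc]
  refine ⟨midpointFlow X, fun t ht x y => midpoint_equation_iff hX (hadm t ht), ?_,
    fun t ht => ⟨isTorusDiffeo_midpointFlow hX hs1 hXs hXp (hadm t ht),
      isSymplectic_midpointFlow hX hX1 (trace_jacobian_hamiltonianField hψ2) (hadm t ht),
      midpointFlow_neg_midpointFlow hX (hadm t ht), fun x => ?_⟩,
    fun t ht => ⟨?_, stepMidpoint X t, stepMidpoint_halfStep_neg hX (hadm t ht),
      halfStep_neg_stepMidpoint hX (hadm t ht),
      (isTorusDiffeo_stepMidpoint hX hs1 hXs hXp (hadm t ht)).2, rfl⟩,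
    fun hs4 => ⟨torusRemainder X, ?_, fun t ht x => ?_⟩⟩
  · rintro ⟨t, x⟩ ⟨ht, -⟩
    exact (contDiffAt_midpointFlow hs1 hX hXs (hadm t ht) x).contDiffWithinAt
  · simpa using midpointFlow_neg_midpointFlow hX (neg_mem_admissibleTimes (hadm t ht)) x
  · have := (isTorusDiffeo_stepMidpoint hX hs1 hXs hXp (neg_mem_admissibleTimes (hadm t ht))).1
    rwa [neg_neg] at this
  · rintro ⟨t, x⟩ ⟨ht, -⟩
    refine ContDiffAt.contDiffWithinAt ?_ |>.congr
      (f := fun p : ℝ × Plane => modifiedFieldRemainder X p.1 p.2)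
      (fun p hp => torusRemainder_proj hX hX1 hXp (hadm p.1 hp.1) p.2)
      (torusRemainder_proj hX hX1 hXp (hadm t ht) x)
    exact contDiffAt_modifiedFieldRemainder hX
      (hXs.of_le (by exact_mod_cast (by omega : s - 4 + 2 ≤ s - 1))) (hadm t ht) x
  · rw [torusRemainder_proj hX hX1 hXp (hadm t ht)]
    exact (hasDerivAt_midpointFlow_neg hX hX2 (hadm t ht) x).hasDerivWithinAt
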